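/- Notation: $(a)_n=a(a+1)\cdots(a+n-1)$; for $\mathbf h=(h_1,\dots,h_l)\in\mathbb C^l$ and $\mathbf p=(p_1,\dots,p_l)\in\mathbb N^l$ ($\mathbb N\ni 0$) put $p=p_1+\cdots+p_l$, $(\mathbf h)_{\mathbf p}=\prod_{i=1}^l(h_i)_{p_i}$, and let scalars be added to vectors componentwise. $F\left({\mathbf a\atop\mathbf b}\right)=\sum_{n\ge0}\frac{\prod_i(a_i)_n}{\prod_j(b_j)_n\,n!}$ is the generalized hypergeometric series at argument $1$; it terminates if some $a_i$ is a non-positive integer. The function $1/\Gamma$ is understood as an entire function. Let $l\in\mathbb N$, $u,v\in\mathbb Z$, $d,e,\lambda\in\mathbb C$, $\mathbf h\in\mathbb C^l$, $\mathbf p\in\mathbb N^l$, and assume that no $1-h_i+d-p_i$ is a non-positive integer. Define $$Y_p(u,v;t)=\frac{(\mathbf h-d)_{\mathbf p}}{\Gamma(e-d)}\sum_{j=0}^{p}\frac{(d-e+1)_{j}}{j!}\,F\!\left({-j,\,1-\mathbf h+d\atop 1-\mathbf h+d-\mathbf p}\right)(ut+d)_{j}\,(vt+d-e-\lambda+j+1)_{p-j}.$$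 (i) Let $k\in\mathbb N$ be such that neither $e+uk$ nor any $h_i+uk$ is a non-positive integer, and suppose that $\Re(e+\lambda-d-p-vk)>0$ or that the series $F$ below terminates. Then the series converges absolutely and $$F\!\left({-\lambda+vk,\;d+uk,\;\mathbf h+\mathbf p+uk\atop e+uk,\;\mathbf h+uk}\right)=\frac{(-1)^{vk}\,\Gamma(e+\lambda-d)\,\Gamma(1+d-e-\lambda)\,\Gamma(e+uk)\,Y_p(u,v;k)}{(\mathbf h+uk)_{\mathbf p}\,\Gamma((u-v)k+e+\lambda)\,\Gamma(vk+d-e-\lambda+p+1)},$$ literally if $e+\lambda-d\notin\mathbb Z$. In all cases, including $e+\lambda-d\in\mathbb Z$ (where a gamma factor of the right-hand side has a pole), the left-hand side is the limit of the right-hand side with $e$ replaced by $e'$ as $e'\to e$, $e'\ne e$. (ii) $Y_p(u,v;t)$ is a polynomial in $t$ of degree at most $p$, and its coefficient of $t^p$ is $$\frac{(\mathbf h-d)_{\mathbf p}}{\Gamma(e-d)}\sum_{j=0}^{p}\frac{(d-e+1)_{j}}{j!}\,F\!\left({-j,\,1-\mathbf h+d\atop 1-\mathbf h+d-\mathbf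 p}\right)u^{j}v^{p-j}.$$ If $(u,v)\neq(0,0)$, then, with the other parameters fixed, this coefficient is nonzero, that is, the degree is exactly $p$, for all $e\in\mathbb C$ outside a countable set. (iii) For $e=d+1$ one has $Y_p(u,v;t)=(\mathbf h-d)_{\mathbf p}(vt-\lambda)_p$ for all $t\in\mathbb C$, and the formula contains the Karlsson–Minton summation theorem: if $a\in\mathbb C$, $\Re(a+p)<1$ and neither $d+1$ nor any $h_i$ is a non-positive integer, then $$F\!\left({a,\;d,\;\mathbf h+\mathbf p\atop d+1,\;\mathbf h}\right)=\frac{\Gamma(d+1)\,\Gamma(1-a)\,(\mathbf h-d)_{\mathbf p}}{\Gamma(d+1-a)\,(\mathbf h)_{\mathbf p}}.$$ -/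

import Mathlib

open Filter Topology

noncomputable section

/-- The rising factorial `(a)_n = a (a + 1) ⋯ (a + n - 1)`. -/
def poch (a : ℂ) (n : ℕ) : ℂ := (ascPochhammer ℂ n).eval a

/-- The `n`-th term of the generalized hypergeometric series with upper parameters `a`,
lower parameters `b` and argument `x`. -/
def hypTerm (a b : List ℂ) (x : ℂ) (n : ℕ) : ℂ :=
  (a.map fun α => poch α n).prod / ((b.map fun β => poch β n).prod * (n.factorial : ℂ)) * x ^ n

/-- The generalized hypergeometric function, as the sum of its series. -/
def hypF (a b : List ℂ) (x : ℂ) : ℂ := ∑' n : ℕ, hypTerm a b x n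

/-- `z` is one of `0, -1, -2, …`. -/
def IsNonposInt (z : ℂ) : Prop := ∃ n : ℕ, z = -(n : ℂ)

/-- The hypergeometric series with upper parameters `a` terminates. -/
def Terminates (a : List ℂ) : Prop := ∃ α ∈ a, IsNonposInt α

/-- The product `(h₁)_{p₁} ⋯ (h_l)_{p_l}`. -/
def vecPoch {l : ℕ} (h : Fin l → ℂ) (p : Fin l → ℕ) : ℂ := ∏ i, poch (h i) (p i)

/-- The upper parameters `-λ + v k`, `d + u k`, `h + p + u k`. -/
def ipdUpper {l : ℕ} (p : Fin l → ℕ) (h : Fin l → ℂ) (u v : ℤ) (d lam : ℂ) (k : ℕ) : List ℂ :=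
  (-lam + v * k) :: (d + u * k) :: List.ofFn fun i => h i + p i + u * k

/-- The lower parameters `e + u k`, `h + u k`. -/
def ipdLower {l : ℕ} (h : Fin l → ℂ) (u : ℤ) (e : ℂ) (k : ℕ) : List ℂ :=
  (e + u * k) :: List.ofFn fun i => h i + u * k

/-- The terminating value `F(-j, 1 - h + d; 1 - h + d - p)` at argument `1`. -/
def ipdInner {l : ℕ} (p : Fin l → ℕ) (h : Fin l → ℂ) (d : ℂ) (j : ℕ) : ℂ :=
  hypF ((-(j : ℂ)) :: List.ofFn fun i => 1 - h i + d)
    (List.ofFn fun i => 1 - h i + d - p i) 1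

/-- `Y_p(u, v; t)`, where `p` in the subscript is the sum of the `p i`. Since `Complex.Gamma`
is `0` at its poles, the factor `1 / Γ(e - d)` is the entire reciprocal gamma function. -/
def ipdY {l : ℕ} (p : Fin l → ℕ) (h : Fin l → ℂ) (u v : ℤ) (d e lam t : ℂ) : ℂ :=
  vecPoch (fun i => h i - d) p / Complex.Gamma (e - d) *
    ∑ j ∈ Finset.range (∑ i, p i + 1),
      poch (d - e + 1) j / (j.factorial : ℂ) * ipdInner p h d j * poch (u * t + d) j *
        poch (v * t + d - e - lam + j + 1) (∑ i, p i - j)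

/-- The coefficient of `t ^ p` in `Y_p(u, v; t)`. -/
def ipdLead {l : ℕ} (p : Fin l → ℕ) (h : Fin l → ℂ) (u v : ℤ) (d e : ℂ) : ℂ :=
  vecPoch (fun i => h i - d) p / Complex.Gamma (e - d) *
    ∑ j ∈ Finset.range (∑ i, p i + 1),
      poch (d - e + 1) j / (j.factorial : ℂ) * ipdInner p h d j *
        (u : ℂ) ^ j * (v : ℂ) ^ (∑ i, p i - j)

/-- The gamma-function evaluation, meaningful as it stands when `e + λ - d` is not an integer. -/
def ipdRHS {l : ℕ} (p : Fin l → ℕ) (h : Fin l → ℂ) (u v : ℤ) (d e lam : ℂ) (k : ℕ) : ℂ :=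
  (-1 : ℂ) ^ (v * (k : ℤ)) * Complex.Gamma (e + lam - d) * Complex.Gamma (1 + d - e - lam) *
      Complex.Gamma (e + u * k) * ipdY p h u v d e lam k /
    (vecPoch (fun i => h i + u * k) p * Complex.Gamma (((u : ℂ) - v) * k + e + lam) *
      Complex.Gamma (v * k + d - e - lam + (∑ i, p i : ℕ) + 1))

end

/-! The product `∏ (h_i - d + x)_{p_i}` is a polynomial in `x`; its Newton expansion in the basis
`(x)_j` has coefficients `c_j = (h - d)_p F(-j, …) / j!` (`ipdNewton_eq_fwdDiff`,
`prod_poch_eq_sum`). At `x = d + uk + n` it equals `(h + uk)_p` times the factor that the parameters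
`h` contribute to the `n`-th term. Since `(b)_n (b + n)_j = (b)_j (b + j)_n`, the series becomes a
finite combination of Gauss series `₂F₁(-λ + vk, d + uk + j; e + uk; 1)` (`hypTerm_ipd`). Gauss's
theorem and the reflection formula turn these into the gamma quotient (`sum_gauss_eq_ipdRHS`). The
Gauss sums are continuous in the lower parameter (`continuousAt_tsum_gaussTerm`), which gives the
limit when `e + λ - d` is an integer. The leading coefficient is `1 / Γ(e - d)` times a nonzero
polynomial in `e`. For `e = d + 1` only `j = 0` survives. -/

/-! ### Pochhammer symbols and the reciprocal gamma function -/

theorem poch_zero (a : ℂ) : poch a 0 = 1 := by simp [poch]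

theorem poch_succ (a : ℂ) (n : ℕ) : poch a (n + 1) = poch a n * (a + n) :=
  ascPochhammer_succ_eval n a

theorem poch_one (a : ℂ) : poch a 1 = a := by simp [poch]

theorem poch_add (a : ℂ) (m n : ℕ) : poch a (m + n) = poch a m * poch (a + m) n := by
  induction n with
  | zero => simp [poch_zero]
  | succ n ih => rw [← add_assoc, poch_succ, poch_succ, ih]; push_cast; ring

theorem poch_eq_prod (a : ℂ) (n : ℕ) : poch a n = ∏ i ∈ Finset.range n, (a + i) := by
  induction n with
  | zero => simp [poch_zero]
  | succ n ih => rw [poch_succ, Finset.prod_range_succ, ih]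

theorem poch_ne_zero {a : ℂ} (ha : ¬ IsNonposInt a) (n : ℕ) : poch a n ≠ 0 := by
  rw [poch_eq_prod, Finset.prod_ne_zero_iff]
  exact fun i _ hi => ha ⟨i, eq_neg_of_add_eq_zero_left hi⟩

theorem poch_neg_natCast_eq_zero {m n : ℕ} (h : m < n) : poch (-(m : ℂ)) n = 0 := by
  rw [poch_eq_prod]
  exact Finset.prod_eq_zero (Finset.mem_range.2 h) (by simp)

theorem IsNonposInt.of_add_natCast {z : ℂ} {n : ℕ} (h : IsNonposInt (z + n)) : IsNonposInt z := by
  obtain ⟨m, hm⟩ := h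
  exact ⟨m + n, by push_cast; linear_combination hm⟩

theorem IsNonposInt.re_nonpos {z : ℂ} (h : IsNonposInt z) : z.re ≤ 0 := by
  obtain ⟨m, rfl⟩ := h
  simp

theorem Gamma_ne_zero_of_not_isNonposInt {z : ℂ} (h : ¬ IsNonposInt z) : Complex.Gamma z ≠ 0 :=
  fun h0 => h ((Complex.Gamma_eq_zero_iff z).1 h0)

/-- The reflection `(1 - x)_m = (-1)^m (x - m)_m`. -/
theorem poch_one_sub (x : ℂ) (m : ℕ) : poch (1 - x) m = (-1) ^ m * poch (x - m) m := by
  induction m with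
  | zero => simp [poch_zero]
  | succ m ih =>
    rw [poch_succ, ih, add_comm m 1, poch_add, poch_one]
    push_cast
    rw [show x - (1 + (m : ℂ)) + 1 = x - m by ring]
    ring

/-- After reflection, both sides split `(x - m)_{p + m}` in two ways. This turns the terms of the
inner series into values of a polynomial at `-m`. -/
theorem poch_sub_mul_poch (x : ℂ) (m p : ℕ) :
    poch (x - m) p * poch (1 - x - p) m = poch x p * poch (1 - x) m := by
  have h1 : poch (x - m) (p + m) = poch (x - m) (m + p) := by rw [add_comm]
  rw [poch_add, poch_add, sub_add_cancel] at h1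
  rw [sub_sub, poch_one_sub, poch_one_sub]
  rw [show x + (p : ℂ) - m = x - m + p by ring]
  linear_combination (-1) ^ m * h1

theorem inv_Gamma_eq_poch_mul (s : ℂ) (n : ℕ) :
    (Complex.Gamma s)⁻¹ = poch s n * (Complex.Gamma (s + n))⁻¹ := by
  induction n with
  | zero => simp [poch_zero]
  | succ n ih =>
    rw [ih, poch_succ, Complex.one_div_Gamma_eq_self_mul_one_div_Gamma_add_one (s + n)]
    push_cast
    rw [add_assoc s]
    ring

theorem poch_succ_eq_cpow_mul (s : ℂ) {n : ℕ} (hn : n ≠ 0) :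
    poch s (n + 1) = (n : ℂ) ^ s * n.factorial * (Complex.GammaSeq s n)⁻¹ := by
  have h1 : (n : ℂ) ^ s ≠ 0 := by simp [Complex.cpow_eq_zero_iff, hn]
  have h2 : (n.factorial : ℂ) ≠ 0 := by exact_mod_cast n.factorial_ne_zero
  rw [Complex.GammaSeq, ← poch_eq_prod, inv_div]
  field_simp

theorem tendsto_inv_GammaSeq (s : ℂ) :
    Tendsto (fun n => (Complex.GammaSeq s n)⁻¹) atTop (𝓝 (Complex.Gamma s)⁻¹) := by
  by_cases hs : IsNonposInt s
  · have h0 : Complex.Gamma s = 0 := (Complex.Gamma_eq_zero_iff s).2 hs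
    obtain ⟨m, rfl⟩ := hs
    rw [h0, inv_zero]
    refine tendsto_const_nhds.congr' ?_
    -- At a pole, `GammaSeq` eventually has denominator zero, so it and its inverse are `0` by
    -- convention, matching `1 / Γ = 0`.
    filter_upwards [eventually_ge_atTop m] with n hn
    rw [Complex.GammaSeq, ← poch_eq_prod, poch_neg_natCast_eq_zero (by omega)]
    simp
  · exact (Complex.GammaSeq_tendsto_Gamma s).inv₀ (Gamma_ne_zero_of_not_isNonposInt hs)

/-! ### Gauss's theorem at argument 1 -/

/-- The `n`-th term of Gauss's series `₂F₁(a, b; c; 1)`. -/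
noncomputable def gaussTerm (a b c : ℂ) (n : ℕ) : ℂ :=
  poch a n * poch b n / (poch c n * n.factorial)

/-- Gauss's series `₂F₁(a, b; c; 1)` converges absolutely or terminates. -/
def GaussCond (a b c : ℂ) : Prop := 0 < (c - a - b).re ∨ IsNonposInt a ∨ IsNonposInt b

theorem GaussCond.add_natCast {a b c : ℂ} (h : GaussCond a b c) (n : ℕ) :
    GaussCond a b (c + n) := by
  refine h.imp (fun h => ?_) id
  simp only [Complex.sub_re, Complex.add_re, Complex.natCast_re] at h ⊢
  have : (0 : ℝ) ≤ n := n.cast_nonneg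
  linarith

theorem gaussTerm_zero (a b c : ℂ) : gaussTerm a b c 0 = 1 := by simp [gaussTerm, poch_zero]

theorem gaussTerm_succ (a b c : ℂ) (n : ℕ) :
    gaussTerm a b c (n + 1) = gaussTerm a b c n * ((a + n) * (b + n) / ((c + n) * (n + 1))) := by
  simp only [gaussTerm, poch_succ, Nat.factorial_succ]
  push_cast
  rw [div_mul_div_comm]
  congr 1 <;> ring

/-- The cutoff does not depend on `c`, which the continuity in `c` needs. -/
theorem gaussTerm_eq_zero_of_terminates {a b : ℂ} (h : IsNonposInt a ∨ IsNonposInt b) :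
    ∃ m : ℕ, ∀ c, ∀ n, m ≤ n → gaussTerm a b c n = 0 := by
  rcases h with ⟨m, rfl⟩ | ⟨m, rfl⟩ <;>
  · refine ⟨m + 1, fun c n hn => ?_⟩
    simp [gaussTerm, poch_neg_natCast_eq_zero (show m < n by omega)]

/-- The second factor converges, so terms are `O(n^(a + b - c - 1))`: this yields both summability
and the vanishing of the telescoping boundary term. -/
theorem gaussTerm_succ_eq_cpow_mul (a b c : ℂ) {n : ℕ} (hn : n ≠ 0) :
    (n + 1) * gaussTerm a b c (n + 1) = (n : ℂ) ^ (a + b - c) *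
      ((Complex.GammaSeq a n)⁻¹ * (Complex.GammaSeq b n)⁻¹ / (Complex.GammaSeq c n)⁻¹) := by
  have hn' : (n : ℂ) ≠ 0 := by exact_mod_cast hn
  have h2 : (n.factorial : ℂ) ≠ 0 := by exact_mod_cast n.factorial_ne_zero
  have h3 : (n : ℂ) + 1 ≠ 0 := by exact_mod_cast n.succ_ne_zero
  have h4 : (n : ℂ) ^ c ≠ 0 := by simp [Complex.cpow_eq_zero_iff, hn]
  rw [gaussTerm, poch_succ_eq_cpow_mul a hn, poch_succ_eq_cpow_mul b hn,
    poch_succ_eq_cpow_mul c hn, Nat.factorial_succ, Complex.cpow_sub _ _ hn',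
    Complex.cpow_add _ _ hn']
  push_cast
  field_simp

theorem tendsto_GammaSeq_quotient (a b : ℂ) {c : ℂ} (hc : ¬ IsNonposInt c) :
    Tendsto (fun n => (Complex.GammaSeq a n)⁻¹ * (Complex.GammaSeq b n)⁻¹ /
      (Complex.GammaSeq c n)⁻¹) atTop
      (𝓝 ((Complex.Gamma a)⁻¹ * (Complex.Gamma b)⁻¹ / (Complex.Gamma c)⁻¹)) :=
  ((tendsto_inv_GammaSeq a).mul (tendsto_inv_GammaSeq b)).div (tendsto_inv_GammaSeq c)
    (inv_ne_zero (Gamma_ne_zero_of_not_isNonposInt hc))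

theorem tendsto_natCast_mul_gaussTerm {a b c : ℂ} (hc : ¬ IsNonposInt c) (h : GaussCond a b c) :
    Tendsto (fun n : ℕ => (n : ℂ) * gaussTerm a b c n) atTop (𝓝 0) := by
  rcases h with h | h
  · rw [← tendsto_add_atTop_iff_nat 1]
    have h1 : Tendsto (fun n : ℕ => (n : ℂ) ^ (a + b - c)) atTop (𝓝 0) := by
      rw [tendsto_zero_iff_norm_tendsto_zero]
      refine ((tendsto_rpow_neg_atTop h).comp tendsto_natCast_atTop_atTop).congr' ?_
      filter_upwards [eventually_gt_atTop 0] with n hn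
      rw [Complex.norm_natCast_cpow_of_pos hn, Function.comp_apply]
      congr 1
      simp only [Complex.sub_re, Complex.add_re]
      ring
    have h2 := h1.mul (tendsto_GammaSeq_quotient a b hc)
    rw [zero_mul] at h2
    refine h2.congr' ?_
    filter_upwards [eventually_ne_atTop 0] with n hn
    rw [← gaussTerm_succ_eq_cpow_mul a b c hn]
    push_cast
    rfl
  · obtain ⟨m, hm⟩ := gaussTerm_eq_zero_of_terminates h
    refine tendsto_const_nhds.congr' ?_
    filter_upwards [eventually_ge_atTop m] with n hn
    rw [hm c n hn, mul_zero]

theorem summable_gaussTerm {a b c : ℂ} (hc : ¬ IsNonposInt c) (h : GaussCond a b c) :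
    Summable (gaussTerm a b c) := by
  rcases h with h | h
  · rw [← summable_nat_add_iff 1]
    refine summable_of_isBigO_nat (g := fun n : ℕ => (n : ℝ) ^ ((a + b - c).re - 1))
      (Real.summable_nat_rpow.2 ?_) ?_
    · simp only [Complex.sub_re, Complex.add_re] at h ⊢
      linarith
    · have h1 := (tendsto_GammaSeq_quotient a b hc).isBigO_one ℝ
      have h2 : (fun n : ℕ => (n : ℂ) ^ (a + b - c) / (n + 1)) =O[atTop]
          fun n : ℕ => (n : ℝ) ^ ((a + b - c).re - 1) := by
        refine Asymptotics.IsBigO.of_bound 1 ?_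
        filter_upwards [eventually_gt_atTop 0] with n hn
        have hn' : (0 : ℝ) < n := by exact_mod_cast hn
        have h3 : ‖(n : ℂ) + 1‖ = n + 1 := by
          rw [← Nat.cast_add_one, Complex.norm_natCast]; push_cast; rfl
        rw [norm_div, h3, Complex.norm_natCast_cpow_of_pos hn, one_mul,
          Real.norm_of_nonneg (by positivity), Real.rpow_sub_one hn'.ne']
        gcongr
        linarith
      have h4 := h2.mul h1
      simp only [mul_one] at h4
      refine h4.congr' ?_ EventuallyEq.rfl
      filter_upwards [eventually_ne_atTop 0] with n hn
      have h3 : (n : ℂ) + 1 ≠ 0 := by exact_mod_cast n.succ_ne_zero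
      rw [div_mul_eq_mul_div, ← gaussTerm_succ_eq_cpow_mul a b c hn, mul_div_cancel_left₀ _ h3]
  · obtain ⟨m, hm⟩ := gaussTerm_eq_zero_of_terminates h
    exact summable_of_ne_finset_zero (s := Finset.range m)
      fun n hn => hm c n (by simpa using hn)

theorem not_isNonposInt_add_natCast {c : ℂ} (hc : ¬ IsNonposInt c) (n : ℕ) :
    ¬ IsNonposInt (c + n) := fun h => hc h.of_add_natCast

theorem add_natCast_ne_zero {c : ℂ} (hc : ¬ IsNonposInt c) (n : ℕ) : c + n ≠ 0 :=
  fun h => hc ⟨n, eq_neg_of_add_eq_zero_left h⟩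

theorem gaussTerm_add_one {a b c : ℂ} (hc : ¬ IsNonposInt c) (n : ℕ) :
    gaussTerm a b (c + 1) n = gaussTerm a b c n * (c / (c + n)) := by
  have h1 := poch_add c 1 n
  rw [add_comm 1 n, poch_succ, poch_one, Nat.cast_one] at h1
  have h2 := add_natCast_ne_zero hc n
  have h3 : c ≠ 0 := by simpa using add_natCast_ne_zero hc 0
  have h4 := poch_ne_zero hc n
  have h5 : poch (c + 1) n ≠ 0 := by
    have := poch_ne_zero (not_isNonposInt_add_natCast hc 1) n
    rwa [Nat.cast_one] at this
  have h2 : (n.factorial : ℂ) ≠ 0 := by exact_mod_cast n.factorial_ne_zero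
  rw [gaussTerm, gaussTerm, div_mul_div_comm, div_eq_div_iff (by positivity) (by positivity)]
  linear_combination (poch a n * poch b n * n.factorial) * h1

/-- The contiguous relation `c (c - a - b) F(c) = (c - a) (c - b) F(c + 1)` at argument `1`. -/
theorem tsum_gaussTerm_contiguous {a b c : ℂ} (hc : ¬ IsNonposInt c) (h : GaussCond a b c) :
    c * (c - a - b) * ∑' n, gaussTerm a b c n =
      (c - a) * (c - b) * ∑' n, gaussTerm a b (c + 1) n := by
  have hc1 : ¬ IsNonposInt (c + 1) := by
    simpa using not_isNonposInt_add_natCast hc 1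
  have h1 : GaussCond a b (c + 1) := by simpa using h.add_natCast 1
  have hs := ((summable_gaussTerm hc h).hasSum.mul_left (c * (c - a - b))).sub
    ((summable_gaussTerm hc1 h1).hasSum.mul_left ((c - a) * (c - b)))
  have hlim := hs.tendsto_sum_nat
  -- The relation holds termwise up to a telescoping difference, whose boundary term tends to `0`.
  have htel : ∀ N : ℕ, ∑ n ∈ Finset.range N, (c * (c - a - b) * gaussTerm a b c n -
      (c - a) * (c - b) * gaussTerm a b (c + 1) n) = -c * (N * gaussTerm a b c N) := by
    intro N
    induction N with
    | zero => simp
    | succ N ih =>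
      have h2 := add_natCast_ne_zero hc N
      have h3 : (N : ℂ) + 1 ≠ 0 := by exact_mod_cast N.succ_ne_zero
      rw [Finset.sum_range_succ, ih, gaussTerm_add_one hc, gaussTerm_succ]
      push_cast
      field_simp
      ring
  have h0 := (tendsto_natCast_mul_gaussTerm hc h).const_mul (-c)
  rw [mul_zero] at h0
  exact sub_eq_zero.1 (tendsto_nhds_unique hlim (h0.congr fun N => (htel N).symm))

theorem norm_poch_le_norm_poch_add {c : ℂ} (hc : 0 < c.re) (n k : ℕ) :
    ‖poch c k‖ ≤ ‖poch (c + n) k‖ := by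
  rw [poch_eq_prod, poch_eq_prod, norm_prod, norm_prod]
  refine Finset.prod_le_prod (fun _ _ => norm_nonneg _) fun i _ => ?_
  rw [Complex.norm_def, Complex.norm_def]
  refine Real.sqrt_le_sqrt ?_
  rw [Complex.normSq_apply, Complex.normSq_apply]
  simp only [Complex.add_re, Complex.natCast_re, Complex.add_im, Complex.natCast_im]
  have hn : (0 : ℝ) ≤ n := n.cast_nonneg
  have hi : (0 : ℝ) ≤ i := i.cast_nonneg
  nlinarith [mul_nonneg hn hi, mul_nonneg hn hc.le]

theorem tendsto_gaussTerm_add_natCast (a b c : ℂ) (k : ℕ) :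
    Tendsto (fun n : ℕ => gaussTerm a b (c + n) k) atTop (𝓝 (if k = 0 then 1 else 0)) := by
  induction k with
  | zero => simp [gaussTerm_zero]
  | succ k ih =>
    simp only [gaussTerm_succ]
    have h1 : Tendsto (fun n : ℕ => (c + k) + (n : ℂ)) atTop (Bornology.cobounded ℂ) :=
      tendsto_const_add_cobounded _ |>.comp tendsto_natCast_atTop_cobounded
    have h2 := (tendsto_inv₀_cobounded.comp h1).const_mul ((a + k) * (b + k) / ((k : ℂ) + 1))
    have h3 := ih.mul h2
    simp only [mul_zero] at h3
    simp only [Nat.add_eq_zero_iff, one_ne_zero, and_false, if_false]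
    refine h3.congr fun n => ?_
    simp only [Function.comp_apply]
    rw [add_right_comm c, ← div_eq_mul_inv, div_div, mul_comm ((k : ℂ) + 1)]

theorem tendsto_tsum_gaussTerm_add_natCast {a b c : ℂ} (hc : ¬ IsNonposInt c)
    (h : GaussCond a b c) :
    Tendsto (fun n : ℕ => ∑' k, gaussTerm a b (c + n) k) atTop (𝓝 1) := by
  -- Once the real part is positive, the denominators only grow in norm under further shifts, so the
  -- series at `c + m` dominates all later ones.
  obtain ⟨m, hm⟩ := exists_nat_gt (-c.re)
  have hre : 0 < (c + m).re := by
    simp only [Complex.add_re, Complex.natCast_re]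
    linarith
  rw [← tendsto_add_atTop_iff_nat m]
  have key := tendsto_tsum_of_dominated_convergence (𝓕 := atTop)
    (f := fun n : ℕ => fun k => gaussTerm a b (c + m + n) k)
    (summable_gaussTerm (not_isNonposInt_add_natCast hc m) (h.add_natCast m)).norm
    (tendsto_gaussTerm_add_natCast a b (c + m)) (Eventually.of_forall fun n k => ?_)
  · rw [tsum_ite_eq] at key
    refine key.congr fun n => ?_
    push_cast
    simp only [add_assoc, add_comm (m : ℂ)]
  · have h0 := norm_pos_iff.2 (poch_ne_zero (not_isNonposInt_add_natCast hc m) k)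
    have := norm_poch_le_norm_poch_add hre n k
    have h1 : 0 < ‖(k.factorial : ℂ)‖ := norm_pos_iff.2 (by exact_mod_cast k.factorial_ne_zero)
    simp only [gaussTerm, norm_div, norm_mul]
    gcongr

/-- **Gauss's theorem**, for convergent and for terminating series. -/
theorem tsum_gaussTerm {a b c : ℂ} (hc : ¬ IsNonposInt c) (h : GaussCond a b c)
    (hs : ¬ IsNonposInt (c - a - b)) :
    ∑' n, gaussTerm a b c n = Complex.Gamma c * Complex.Gamma (c - a - b) *
      ((Complex.Gamma (c - a))⁻¹ * (Complex.Gamma (c - b))⁻¹) := by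
  -- Iterate the contiguous relation; as `n → ∞` the shifted sum tends to `1` and the Pochhammer
  -- symbols become reciprocal gammas.
  have h1 : ∀ n : ℕ, poch c n * poch (c - a - b) n * ∑' k, gaussTerm a b c k =
      poch (c - a) n * poch (c - b) n * ∑' k, gaussTerm a b (c + n) k := by
    intro n
    induction n with
    | zero => simp [poch_zero]
    | succ n ih =>
      have h2 := tsum_gaussTerm_contiguous (not_isNonposInt_add_natCast hc n) (h.add_natCast n)
      simp only [poch_succ]
      push_cast
      rw [← add_assoc]
      linear_combination (c + n) * (c - a - b + n) * ih + poch (c - a) n * poch (c - b) n * h2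
  have h2 : ∀ n : ℕ, n ≠ 0 → (Complex.GammaSeq c n)⁻¹ * (Complex.GammaSeq (c - a - b) n)⁻¹ *
      ∑' k, gaussTerm a b c k = (Complex.GammaSeq (c - a) n)⁻¹ * (Complex.GammaSeq (c - b) n)⁻¹ *
      ∑' k, gaussTerm a b (c + (n + 1 : ℕ)) k := by
    intro n hn
    have h3 := h1 (n + 1)
    rw [poch_succ_eq_cpow_mul _ hn, poch_succ_eq_cpow_mul _ hn, poch_succ_eq_cpow_mul _ hn,
      poch_succ_eq_cpow_mul _ hn] at h3
    have hn' : (n : ℂ) ≠ 0 := by exact_mod_cast hn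
    -- The powers of `n` cancel because `c + (c - a - b) = (c - a) + (c - b)`.
    have hp : (n : ℂ) ^ c * (n : ℂ) ^ (c - a - b) = (n : ℂ) ^ (c - a) * (n : ℂ) ^ (c - b) := by
      rw [← Complex.cpow_add _ _ hn', ← Complex.cpow_add _ _ hn']
      congr 1
      ring
    have hp0 : (n : ℂ) ^ (c - a) * (n : ℂ) ^ (c - b) * n.factorial * n.factorial ≠ 0 := by
      have h2 : (n.factorial : ℂ) ≠ 0 := by exact_mod_cast n.factorial_ne_zero
      simp [Complex.cpow_eq_zero_iff, hn, h2]
    refine mul_left_cancel₀ hp0 ?_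
    linear_combination h3 - (n.factorial * n.factorial * (Complex.GammaSeq c n)⁻¹ *
      (Complex.GammaSeq (c - a - b) n)⁻¹ * ∑' k, gaussTerm a b c k) * hp
  have hL := ((tendsto_inv_GammaSeq c).mul (tendsto_inv_GammaSeq (c - a - b))).mul_const
    (∑' k, gaussTerm a b c k)
  have hR := ((tendsto_inv_GammaSeq (c - a)).mul (tendsto_inv_GammaSeq (c - b))).mul
    ((tendsto_add_atTop_iff_nat 1).2 (tendsto_tsum_gaussTerm_add_natCast hc h))
  have hE := tendsto_nhds_unique (hL.congr' (by
    filter_upwards [eventually_ne_atTop 0] with n hn using h2 n hn)) hR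
  have g1 := Gamma_ne_zero_of_not_isNonposInt hc
  have g2 := Gamma_ne_zero_of_not_isNonposInt hs
  rw [mul_one] at hE
  rw [← hE]
  field_simp

/-! ### Continuity of the Gauss sum in the lower parameter -/

theorem isOpen_not_isNonposInt : IsOpen {c : ℂ | ¬ IsNonposInt c} := by
  have h : {c : ℂ | ¬ IsNonposInt c} = {c : ℂ | (Complex.Gamma c)⁻¹ ≠ 0} := by
    ext c
    simp [IsNonposInt, Complex.Gamma_eq_zero_iff]
  rw [h]
  exact isOpen_ne_fun Complex.differentiable_one_div_Gamma.continuous continuous_const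

theorem continuous_poch (n : ℕ) : Continuous fun a => poch a n :=
  (ascPochhammer ℂ n).continuous

theorem not_isNonposInt_of_re_pos {z : ℂ} (h : 0 < z.re) : ¬ IsNonposInt z :=
  fun h' => h.not_ge h'.re_nonpos

theorem continuousAt_Gamma {z : ℂ} (h : ¬ IsNonposInt z) : ContinuousAt Complex.Gamma z :=
  (Complex.differentiableAt_Gamma z fun m hm => h ⟨m, hm⟩).continuousAt

/-- In the convergent case the closed form is continuous. A terminating series may have `c - a - b`
at a pole of `Γ`, so there the finite sum is used directly. -/
theorem continuousAt_tsum_gaussTerm {a b c : ℂ} (hc : ¬ IsNonposInt c) (h : GaussCond a b c) :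
    ContinuousAt (fun c => ∑' n, gaussTerm a b c n) c := by
  rcases h with h | h
  · have hcont : ContinuousAt (fun c => Complex.Gamma c * Complex.Gamma (c - a - b) *
        ((Complex.Gamma (c - a))⁻¹ * (Complex.Gamma (c - b))⁻¹)) c := by
      have hG := Complex.differentiable_one_div_Gamma.continuous
      have h1 : ContinuousAt (fun c => Complex.Gamma (c - a - b)) c :=
        ContinuousAt.comp (g := Complex.Gamma) (f := fun c => c - a - b)
          (continuousAt_Gamma (not_isNonposInt_of_re_pos h)) (by fun_prop)
      have h2 : Continuous fun c => (Complex.Gamma (c - a))⁻¹ := hG.comp (by fun_prop)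
      have h3 : Continuous fun c => (Complex.Gamma (c - b))⁻¹ := hG.comp (by fun_prop)
      exact ((continuousAt_Gamma hc).mul h1).mul (h2.mul h3).continuousAt
    refine hcont.congr ?_
    have hopen : IsOpen {c : ℂ | 0 < (c - a - b).re} :=
      isOpen_lt continuous_const (by fun_prop)
    filter_upwards [hopen.mem_nhds h, isOpen_not_isNonposInt.mem_nhds hc] with c' h1 h2
    exact (tsum_gaussTerm h2 (Or.inl h1) (not_isNonposInt_of_re_pos h1)).symm
  · obtain ⟨m, hm⟩ := gaussTerm_eq_zero_of_terminates h
    have h1 : (fun c => ∑' n, gaussTerm a b c n) =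
        fun c => ∑ n ∈ Finset.range m, gaussTerm a b c n := by
      funext c
      exact tsum_eq_sum fun n hn => hm c n (by simpa using hn)
    rw [h1]
    refine tendsto_finsetSum _ fun n _ => ?_
    refine ContinuousAt.div continuousAt_const
      ((continuous_poch n).continuousAt.mul continuousAt_const) ?_
    exact mul_ne_zero (poch_ne_zero hc n) (by exact_mod_cast n.factorial_ne_zero)

/-! ### Newton expansion of the numerator polynomial -/

open Polynomial in
/-- Newton interpolation at `0, -1, -2, …`. -/
theorem eq_sum_fwdDiff_mul_ascPochhammer (g : ℂ[X]) {N : ℕ} (hg : g.natDegree ≤ N) :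
    g = ∑ j ∈ Finset.range (N + 1),
      C ((-1) ^ j / (j.factorial : ℂ) * (fwdDiff (-1 : ℂ))^[j] (fun x => g.eval x) 0) *
        ascPochhammer ℂ j := by
  have hinj : Function.Injective fun n : ℕ => -(n : ℂ) :=
    fun m n h => by simpa using h
  set s := (Finset.range (N + 1)).map ⟨fun n : ℕ => -(n : ℂ), hinj⟩
  have hcard : s.card = N + 1 := by simp [s]
  have hlt : ∀ f : ℂ[X], f.natDegree ≤ N → f.degree < (s.card : WithBot ℕ) := by
    intro f hf
    rw [hcard]
    exact (natDegree_le_iff_degree_le.1 hf).trans_lt (by exact_mod_cast N.lt_succ_self)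
  -- Both sides have degree at most `N`, so agreement at the `N + 1` nodes suffices; there `(-n)_j =
  -- (-1)^j j! (n choose j)` and the claim is the binomial shift formula.
  refine eq_of_degrees_lt_of_eval_finset_eq s (hlt _ hg) (hlt _ ?_) ?_
  · refine natDegree_sum_le_of_forall_le _ _ fun j hj => (natDegree_C_mul_le _ _).trans ?_
    rw [ascPochhammer_natDegree]
    exact Nat.lt_succ_iff.1 (Finset.mem_range.1 hj)
  · intro x hx
    obtain ⟨n, hn, rfl⟩ := Finset.mem_map.1 hx
    simp only [Function.Embedding.coeFn_mk]
    have h1 := shift_eq_sum_fwdDiff_iter (-1 : ℂ) (fun x => g.eval x) n 0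
    simp only [nsmul_eq_mul, mul_neg, mul_one, zero_add] at h1
    rw [h1, eval_finsetSum]
    have hsub : Finset.range (n + 1) ⊆ Finset.range (N + 1) :=
      Finset.range_subset_range.2 (by have := Finset.mem_range.1 hn; omega)
    rw [← Finset.sum_subset hsub]
    · refine Finset.sum_congr rfl fun j _ => ?_
      have h2 : (j.factorial : ℂ) ≠ 0 := by exact_mod_cast j.factorial_ne_zero
      rw [eval_mul, eval_C, ascPochhammer_eval_neg_eq_descPochhammer,
        descPochhammer_eval_eq_descFactorial, Nat.descFactorial_eq_factorial_mul_choose]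
      push_cast
      have h3 : ((-1 : ℂ) ^ j) * (-1) ^ j = 1 := by rw [← mul_pow]; simp
      field_simp
      linear_combination -(n.choose j : ℂ) * ((fwdDiff (-1 : ℂ))^[j] (fun x => g.eval x) 0) * h3
    · intro j _ hj
      have h4 : poch (-(n : ℂ)) j = 0 :=
        poch_neg_natCast_eq_zero (by simpa [Nat.lt_succ_iff] using hj)
      rw [eval_mul]
      exact mul_eq_zero_of_right _ h4

theorem poch_neg_natCast (j m : ℕ) :
    poch (-(j : ℂ)) m = (-1) ^ m * (m.factorial * j.choose m) := by
  rw [poch, ascPochhammer_eval_neg_eq_descPochhammer, descPochhammer_eval_eq_descFactorial,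
    Nat.descFactorial_eq_factorial_mul_choose]
  push_cast
  rfl

theorem hypTerm_cons_cons (α β γ : ℂ) {l m : ℕ} (a : Fin l → ℂ) (b : Fin m → ℂ) (n : ℕ) :
    hypTerm (α :: β :: List.ofFn a) (γ :: List.ofFn b) 1 n =
      gaussTerm α β γ n * ((∏ i, poch (a i) n) / ∏ i, poch (b i) n) := by
  simp only [hypTerm, gaussTerm, List.map_cons, List.prod_cons, List.map_ofFn, List.prod_ofFn,
    Function.comp_apply, one_pow, mul_one]
  rw [div_mul_div_comm]
  congr 1 <;> ring

section

variable {l : ℕ} (p : Fin l → ℕ) (h : Fin l → ℂ) (d : ℂ)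

/-- The coefficients in `∏ (h_i - d + x)_{p_i} = ∑ c_j (x)_j`. -/
noncomputable def ipdNewton (j : ℕ) : ℂ :=
  vecPoch (fun i => h i - d) p * (ipdInner p h d j / j.factorial)

/-- The polynomial `∏ (h_i - d + x)_{p_i}` in `x`. -/
noncomputable def ipdPoly : Polynomial ℂ :=
  ∏ i, (ascPochhammer ℂ (p i)).comp (Polynomial.X + Polynomial.C (h i - d))

theorem eval_ipdPoly (x : ℂ) : (ipdPoly p h d).eval x = ∏ i, poch (h i - d + x) (p i) := by
  simp only [ipdPoly, Polynomial.eval_prod, Polynomial.eval_comp, Polynomial.eval_add,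
    Polynomial.eval_X, Polynomial.eval_C, poch, add_comm x]

theorem monic_ipdPoly : (ipdPoly p h d).Monic :=
  Polynomial.monic_prod_of_monic _ _ fun i _ =>
    (monic_ascPochhammer ℂ (p i)).comp_X_add_C _

theorem natDegree_ipdPoly : (ipdPoly p h d).natDegree = ∑ i, p i := by
  rw [ipdPoly, Polynomial.natDegree_prod_of_monic]
  · simp only [Polynomial.natDegree_comp, ascPochhammer_natDegree, Polynomial.natDegree_X_add_C,
      mul_one]
  · exact fun i _ => (monic_ascPochhammer ℂ (p i)).comp_X_add_C _

theorem ipdInner_eq_sum (j : ℕ) :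
    ipdInner p h d j = ∑ m ∈ Finset.range (j + 1), poch (-(j : ℂ)) m / m.factorial *
      ((∏ i, poch (1 - h i + d) m) / ∏ i, poch (1 - h i + d - p i) m) := by
  have hterm : ∀ m, hypTerm ((-(j : ℂ)) :: List.ofFn fun i => 1 - h i + d)
      (List.ofFn fun i => 1 - h i + d - p i) 1 m = poch (-(j : ℂ)) m / m.factorial *
      ((∏ i, poch (1 - h i + d) m) / ∏ i, poch (1 - h i + d - p i) m) := by
    intro m
    simp only [hypTerm, List.map_cons, List.prod_cons, List.map_ofFn, List.prod_ofFn,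
      Function.comp_apply, one_pow, mul_one]
    rw [div_mul_div_comm]
    congr 1
    ring
  rw [ipdInner, hypF, tsum_congr hterm]
  refine tsum_eq_sum fun m hm => ?_
  rw [poch_neg_natCast_eq_zero (by simpa [Nat.lt_succ_iff] using hm)]
  simp

theorem ipdInner_zero : ipdInner p h d 0 = 1 := by
  simp [ipdInner_eq_sum, poch_zero]

theorem ipdNewton_zero : ipdNewton p h d 0 = vecPoch (fun i => h i - d) p := by
  simp [ipdNewton, ipdInner_zero]

variable {p h d}

/-- The `j`-th difference is an alternating sum of polynomial values at `-m`, `m ≤ j`;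
`poch_sub_mul_poch` rewrites each as `(h - d)_p` times a term ratio of the inner series. -/
theorem ipdNewton_eq_fwdDiff (hY : ∀ i, ¬ IsNonposInt (1 - h i + d - p i)) (j : ℕ) :
    ipdNewton p h d j = (-1) ^ j / (j.factorial : ℂ) *
      (fwdDiff (-1 : ℂ))^[j] (fun x => (ipdPoly p h d).eval x) 0 := by
  have hfac : (j.factorial : ℂ) ≠ 0 := by exact_mod_cast j.factorial_ne_zero
  rw [ipdNewton, ipdInner_eq_sum, fwdDiff_iter_eq_sum_shift, Finset.sum_div, Finset.mul_sum,
    Finset.mul_sum]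
  refine Finset.sum_congr rfl fun m hm => ?_
  have hmj : m ≤ j := Nat.lt_succ_iff.1 (Finset.mem_range.1 hm)
  have hmf : (m.factorial : ℂ) ≠ 0 := by exact_mod_cast m.factorial_ne_zero
  have hprod : vecPoch (fun i => h i - d) p *
      ((∏ i, poch (1 - h i + d) m) / ∏ i, poch (1 - h i + d - p i) m) =
      ∏ i, poch (h i - d - m) (p i) := by
    rw [vecPoch, ← Finset.prod_div_distrib, ← Finset.prod_mul_distrib]
    refine Finset.prod_congr rfl fun i _ => ?_
    have h1 := poch_sub_mul_poch (h i - d) m (p i)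
    rw [show 1 - (h i - d) = 1 - h i + d by ring] at h1
    rw [← mul_div_assoc, ← h1, mul_div_cancel_right₀ _ (poch_ne_zero (hY i) m)]
  have hev : (ipdPoly p h d).eval (0 + m • (-1 : ℂ)) = ∏ i, poch (h i - d - m) (p i) := by
    rw [eval_ipdPoly]
    simp [sub_eq_add_neg]
  have hsign : (-1 : ℂ) ^ j * (-1) ^ (j - m) = (-1) ^ m := by
    rw [← pow_add, show j + (j - m) = m + 2 * (j - m) by omega, pow_add, pow_mul]
    simp
  rw [hev, ← hprod, poch_neg_natCast, zsmul_eq_mul]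
  push_cast
  rw [← hsign]
  field_simp

/-- The Newton expansion `∏ (h_i - d + x)_{p_i} = ∑ c_j (x)_j`. -/
theorem ipdPoly_eq_sum (hY : ∀ i, ¬ IsNonposInt (1 - h i + d - p i)) :
    ipdPoly p h d = ∑ j ∈ Finset.range (∑ i, p i + 1),
      Polynomial.C (ipdNewton p h d j) * ascPochhammer ℂ j := by
  refine (eq_sum_fwdDiff_mul_ascPochhammer _ (natDegree_ipdPoly p h d).le).trans ?_
  exact Finset.sum_congr rfl fun j _ => by rw [ipdNewton_eq_fwdDiff hY]

theorem prod_poch_eq_sum (hY : ∀ i, ¬ IsNonposInt (1 - h i + d - p i)) (x : ℂ) :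
    ∏ i, poch (h i - d + x) (p i) =
      ∑ j ∈ Finset.range (∑ i, p i + 1), ipdNewton p h d j * poch x j := by
  rw [← eval_ipdPoly, ipdPoly_eq_sum hY, Polynomial.eval_finsetSum]
  simp [poch]

/-- The polynomial is monic and only the last basis element reaches its degree. -/
theorem ipdNewton_sum_eq_one (hY : ∀ i, ¬ IsNonposInt (1 - h i + d - p i)) :
    ipdNewton p h d (∑ i, p i) = 1 := by
  have h1 := (monic_ipdPoly p h d).coeff_natDegree
  rw [natDegree_ipdPoly, ipdPoly_eq_sum hY, Polynomial.finsetSum_coeff, Finset.sum_range_succ,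
    Finset.sum_eq_zero, zero_add, Polynomial.coeff_C_mul] at h1
  · have h2 := (monic_ascPochhammer ℂ (∑ i, p i)).coeff_natDegree
    rw [ascPochhammer_natDegree] at h2
    rwa [h2, mul_one] at h1
  · intro j hj
    refine Polynomial.coeff_eq_zero_of_natDegree_lt ((Polynomial.natDegree_C_mul_le _ _).trans_lt ?_)
    rw [ascPochhammer_natDegree]
    exact Finset.mem_range.1 hj

/-- A zero factor `h_i - d + m` with `m < p_i` would make `1 - h_i + d - p_i` equal to `-(p_i - 1 -
m)`. -/
theorem vecPoch_sub_ne_zero (hY : ∀ i, ¬ IsNonposInt (1 - h i + d - p i)) :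
    vecPoch (fun i => h i - d) p ≠ 0 := by
  rw [vecPoch, Finset.prod_ne_zero_iff]
  intro i _
  rw [poch_eq_prod, Finset.prod_ne_zero_iff]
  intro m hm h0
  have hm' : m < p i := Finset.mem_range.1 hm
  refine hY i ⟨p i - 1 - m, ?_⟩
  rw [Nat.cast_sub (by omega), Nat.cast_sub (by omega)]
  push_cast
  linear_combination -h0

end

/-! ### Reduction to Gauss series and the gamma evaluation -/

section

variable {l : ℕ} {p : Fin l → ℕ} {h : Fin l → ℂ} {u v : ℤ} {d e lam : ℂ} {k : ℕ}

theorem poch_add_natCast_div {H : ℂ} (hH : ¬ IsNonposInt H) (q n : ℕ) :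
    poch (H + q) n / poch H n = poch (H + n) q / poch H q := by
  rw [div_eq_div_iff (poch_ne_zero hH n) (poch_ne_zero hH q)]
  have h1 := poch_add H q n
  rw [add_comm q n, poch_add] at h1
  linear_combination -h1

theorem gaussTerm_mul_poch (a b c : ℂ) (n j : ℕ) :
    gaussTerm a b c n * poch (b + n) j = poch b j * gaussTerm a (b + j) c n := by
  have h1 := poch_add b n j
  rw [add_comm n j, poch_add] at h1
  rw [gaussTerm, gaussTerm, div_mul_eq_mul_div, mul_div_assoc']
  congr 1
  linear_combination -(poch a n) * h1

theorem hypTerm_ipd (hY : ∀ i, ¬ IsNonposInt (1 - h i + d - p i))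
    (hH : ∀ i, ¬ IsNonposInt (h i + u * k)) (n : ℕ) :
    hypTerm (ipdUpper p h u v d lam k) (ipdLower h u e k) 1 n =
      (vecPoch (fun i => h i + u * k) p)⁻¹ * ∑ j ∈ Finset.range (∑ i, p i + 1),
        ipdNewton p h d j * (poch (d + u * k) j *
          gaussTerm (-lam + v * k) (d + u * k + j) (e + u * k) n) := by
  rw [ipdUpper, ipdLower, hypTerm_cons_cons, ← Finset.prod_div_distrib]
  -- The Newton variable is `x = d + uk + n`, so that `(x)_j` can be absorbed into `(d + uk)_n`.
  have h1 : ∏ i, poch (h i + p i + u * k) n / poch (h i + u * k) n =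
      (∏ i, poch (h i - d + (d + u * k + n)) (p i)) / vecPoch (fun i => h i + u * k) p := by
    rw [vecPoch, ← Finset.prod_div_distrib]
    refine Finset.prod_congr rfl fun i _ => ?_
    rw [add_right_comm, poch_add_natCast_div (hH i)]
    congr 2
    ring
  rw [h1, prod_poch_eq_sum hY, ← mul_div_assoc, div_eq_inv_mul, Finset.mul_sum]
  congr 1
  refine Finset.sum_congr rfl fun j _ => ?_
  rw [← gaussTerm_mul_poch]
  ring

theorem hasSum_hypTerm_ipd (hY : ∀ i, ¬ IsNonposInt (1 - h i + d - p i))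
    (hE : ¬ IsNonposInt (e + u * k)) (hH : ∀ i, ¬ IsNonposInt (h i + u * k))
    (hG : ∀ j ≤ ∑ i, p i, poch (d + u * k) j = 0 ∨
      GaussCond (-lam + v * k) (d + u * k + j) (e + u * k)) :
    HasSum (hypTerm (ipdUpper p h u v d lam k) (ipdLower h u e k) 1)
      ((vecPoch (fun i => h i + u * k) p)⁻¹ * ∑ j ∈ Finset.range (∑ i, p i + 1),
        ipdNewton p h d j * (poch (d + u * k) j *
          ∑' n, gaussTerm (-lam + v * k) (d + u * k + j) (e + u * k) n)) := by
  rw [funext (hypTerm_ipd hY hH)]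
  refine (hasSum_sum fun j hj => ?_).mul_left _
  refine HasSum.mul_left _ ?_
  rcases hG j (Nat.lt_succ_iff.1 (Finset.mem_range.1 hj)) with h0 | h0
  · simp [h0]
  · exact (summable_gaussTerm hE h0).hasSum.mul_left _

/-- If `d + uk = -m` with `m < j`, the `j`-th Gauss series may diverge, but its coefficient `(d +
uk)_j` vanishes. Termination through some `h_i + p_i + uk` is impossible, as `h_i + uk` would then
be a non-positive integer. -/
theorem gaussCond_of_ipd (hH : ∀ i, ¬ IsNonposInt (h i + u * k))
    (hc : 0 < (e + lam - d - (∑ i, p i : ℕ) - v * k).re ∨ Terminates (ipdUpper p h u v d lam k))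
    {j : ℕ} (hj : j ≤ ∑ i, p i) :
    poch (d + u * k) j = 0 ∨ GaussCond (-lam + v * k) (d + u * k + j) (e + u * k) := by
  rcases hc with hc | ⟨α, hα, ht⟩
  · refine Or.inr (Or.inl (hc.trans_le ?_))
    rw [show e + u * k - (-lam + v * k) - (d + u * k + j) = e + lam - d - j - v * k by ring]
    simp only [Complex.sub_re, Complex.add_re, Complex.natCast_re]
    have : (j : ℝ) ≤ (∑ i, p i : ℕ) := by exact_mod_cast hj
    linarith
  · rw [ipdUpper, List.mem_cons, List.mem_cons, List.mem_ofFn'] at hα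
    rcases hα with rfl | rfl | ⟨i, rfl⟩
    · exact Or.inr (Or.inr (Or.inl ht))
    · obtain ⟨m, hm⟩ := ht
      rcases lt_or_ge m j with hmj | hmj
      · exact Or.inl (by rw [hm, poch_neg_natCast_eq_zero hmj])
      · refine Or.inr (Or.inr (Or.inr ⟨m - j, ?_⟩))
        rw [hm, Nat.cast_sub hmj]
        ring
    · beta_reduce at ht
      rw [add_right_comm] at ht
      exact absurd ht.of_add_natCast (hH i)

theorem not_isNonposInt_of_forall_ne {z : ℂ} (hz : ∀ m : ℤ, z ≠ m) : ¬ IsNonposInt z := by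
  rintro ⟨n, rfl⟩
  exact hz (-n) (by simp)

theorem Gamma_sub_mul_Gamma_one_sub (s : ℂ) (m : ℤ) :
    Complex.Gamma (s - m) * Complex.Gamma (1 - (s - m)) =
      (-1) ^ m * (Complex.Gamma s * Complex.Gamma (1 - s)) := by
  rw [Complex.Gamma_mul_Gamma_one_sub, Complex.Gamma_mul_Gamma_one_sub, mul_sub,
    mul_comm (Real.pi : ℂ) (m : ℂ), Complex.sin_antiperiodic.sub_int_mul_eq]
  rcases Int.even_or_odd m with hm | hm
  · simp [hm.neg_one_zpow, Int.negOnePow_even m hm]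
  · simp [hm.neg_one_zpow, Int.negOnePow_odd m hm, div_neg]

theorem sum_gauss_eq_ipdRHS (hE : ¬ IsNonposInt (e + u * k))
    (hG : ∀ j ≤ ∑ i, p i, poch (d + u * k) j = 0 ∨
      GaussCond (-lam + v * k) (d + u * k + j) (e + u * k))
    (hs : ∀ m : ℤ, e + lam - d ≠ m) :
    (vecPoch (fun i => h i + u * k) p)⁻¹ * ∑ j ∈ Finset.range (∑ i, p i + 1),
        ipdNewton p h d j * (poch (d + u * k) j *
          ∑' n, gaussTerm (-lam + v * k) (d + u * k + j) (e + u * k) n) =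
      ipdRHS p h u v d e lam k := by
  set N := ∑ i, p i with hN
  have hterm : ∀ j ∈ Finset.range (N + 1), ipdNewton p h d j * (poch (d + u * k) j *
      ∑' n, gaussTerm (-lam + v * k) (d + u * k + j) (e + u * k) n) =
      ((-1 : ℂ) ^ (v * (k : ℤ)) * Complex.Gamma (e + lam - d) *
        Complex.Gamma (1 + d - e - lam) * Complex.Gamma (e + u * k) *
        (Complex.Gamma (((u : ℂ) - v) * k + e + lam))⁻¹ *
        (Complex.Gamma (v * k + d - e - lam + N + 1))⁻¹ *
        (vecPoch (fun i => h i - d) p / Complex.Gamma (e - d))) *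
      (poch (d - e + 1) j / (j.factorial : ℂ) * ipdInner p h d j * poch (u * k + d) j *
        poch (v * k + d - e - lam + j + 1) (N - j)) := by
    intro j hj
    have hjN : j ≤ N := Nat.lt_succ_iff.1 (Finset.mem_range.1 hj)
    rcases hG j hjN with h0 | h0
    · rw [add_comm (u * k : ℂ) d, h0]
      simp
    set s := e + lam - d with hsdef
    have hshift : e + u * k - (-lam + v * k) - (d + u * k + j) = s - (v * k + j : ℤ) := by
      rw [hsdef]; push_cast; ring
    have hsn : ∀ m : ℤ, ∀ n : ℤ, s - m ≠ n := fun m n hmn =>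
      hs (n + m) (by push_cast; linear_combination hmn)
    rw [tsum_gaussTerm hE h0 (by rw [hshift]; exact not_isNonposInt_of_forall_ne (hsn _)), hshift]
    have hrefl := Gamma_sub_mul_Gamma_one_sub s (v * k + j)
    have hne : Complex.Gamma (1 - (s - (v * k + j : ℤ))) ≠ 0 := by
      refine Gamma_ne_zero_of_not_isNonposInt (not_isNonposInt_of_forall_ne fun n hn => ?_)
      exact hs (1 - n + (v * k + j)) (by push_cast at hn ⊢; linear_combination -hn)
    -- Reflection moves the `j`-dependent gamma to a denominator; raising its argument by `N - j`
    -- makes it common to all `j`.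
    have h1 := inv_Gamma_eq_poch_mul (1 - (s - (v * k + j : ℤ))) (N - j)
    rw [show (1 - (s - (v * k + j : ℤ)) : ℂ) + (N - j : ℕ) = v * k + d - e - lam + N + 1 by
      rw [Nat.cast_sub hjN, hsdef]; push_cast; ring] at h1
    have h2 : Complex.Gamma (s - (v * k + j : ℤ)) = (-1) ^ (v * k + j : ℤ) *
        (Complex.Gamma s * Complex.Gamma (1 - s)) *
        (Complex.Gamma (1 - (s - (v * k + j : ℤ))))⁻¹ := by
      rw [← hrefl, mul_inv_cancel_right₀ hne]
    -- Here `1 / Γ(e - d - j)` becomes `(-1)^j (d - e + 1)_j / Γ(e - d)`, whose sign cancels the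
    -- `(-1)^j` from reflection.
    have h3 := inv_Gamma_eq_poch_mul (e - d - j) j
    rw [sub_add_cancel] at h3
    have h4 := poch_one_sub (e - d) j
    rw [show 1 - (e - d) = d - e + 1 by ring] at h4
    rw [h2, h1, show 1 - (s - (v * k + j : ℤ)) = v * k + d - e - lam + j + 1 by
        rw [hsdef]; push_cast; ring,
      show 1 - s = 1 + d - e - lam by rw [hsdef]; ring,
      show e + u * k - (d + u * k + j) = e - d - j by ring, h3, h4,
      show e + u * k - (-lam + v * k) = ((u : ℂ) - v) * k + e + lam by ring,
      add_comm (u * k : ℂ) d, zpow_add₀ (by norm_num : (-1 : ℂ) ≠ 0), zpow_natCast, ipdNewton]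
    ring
  rw [Finset.sum_congr rfl hterm, ← Finset.mul_sum, ipdRHS, ipdY, ← hN]
  simp only [div_eq_mul_inv, mul_inv]
  ring

theorem eventually_forall_ne_intCast (e c : ℂ) : ∀ᶠ e' in 𝓝[≠] e, ∀ m : ℤ, e' + c ≠ m := by
  have hcl : IsClosed ((fun m : ℤ => (m : ℂ) - c) '' {m | (m : ℂ) - c ≠ e}) := by
    have : IsClosed ((fun m : ℤ => (m : ℂ)) '' {m | (m : ℂ) - c ≠ e}) :=
      Complex.isClosedEmbedding_intCast.isClosedMap _ (isClosed_discrete _)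
    rw [show (fun m : ℤ => (m : ℂ) - c) = (Homeomorph.subRight c) ∘ fun m : ℤ => (m : ℂ) from rfl,
      Set.image_comp]
    exact (Homeomorph.subRight c).isClosedMap _ this
  have hmem : e ∈ ((fun m : ℤ => (m : ℂ) - c) '' {m | (m : ℂ) - c ≠ e})ᶜ := by
    rintro ⟨m, hm, rfl⟩
    exact hm rfl
  filter_upwards [self_mem_nhdsWithin, nhdsWithin_le_nhds (hcl.isOpen_compl.mem_nhds hmem)]
    with e' h1 h2 m hm
  have h3 : (m : ℂ) - c = e' := by rw [← hm]; ring
  exact h2 ⟨m, by rw [Set.mem_ofPred_eq, h3]; exact h1, h3⟩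

theorem tendsto_ipdRHS (hY : ∀ i, ¬ IsNonposInt (1 - h i + d - p i))
    (hE : ¬ IsNonposInt (e + u * k)) (hH : ∀ i, ¬ IsNonposInt (h i + u * k))
    (hc : 0 < (e + lam - d - (∑ i, p i : ℕ) - v * k).re ∨
      Terminates (ipdUpper p h u v d lam k)) :
    Tendsto (fun e' => ipdRHS p h u v d e' lam k) (𝓝[≠] e)
      (𝓝 (hypF (ipdUpper p h u v d lam k) (ipdLower h u e k) 1)) := by
  -- This combination of Gauss sums has no singularity at `e`, and equals the gamma expression at
  -- nearby `e' ≠ e`, where `e' + λ - d` is not an integer.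
  have hlim : ContinuousAt (fun e' => (vecPoch (fun i => h i + u * k) p)⁻¹ *
      ∑ j ∈ Finset.range (∑ i, p i + 1), ipdNewton p h d j * (poch (d + u * k) j *
        ∑' n, gaussTerm (-lam + v * k) (d + u * k + j) (e' + u * k) n)) e := by
    refine continuousAt_const.mul (tendsto_finsetSum _ fun j hj => ?_)
    refine ContinuousAt.mul continuousAt_const ?_
    rcases gaussCond_of_ipd hH hc (Nat.lt_succ_iff.1 (Finset.mem_range.1 hj)) with h0 | h0
    · simpa [h0] using continuousAt_const
    · exact continuousAt_const.mul (ContinuousAt.comp (f := fun e' : ℂ => e' + u * k)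
        (g := fun c => ∑' n, gaussTerm (-lam + v * k) (d + u * k + j) c n)
        (continuousAt_tsum_gaussTerm hE h0) (by fun_prop))
  have hsum := (hasSum_hypTerm_ipd hY hE hH fun j hj => gaussCond_of_ipd hH hc hj).tsum_eq
  rw [hypF, hsum]
  refine (hlim.tendsto.mono_left nhdsWithin_le_nhds).congr' ?_
  have hE' : ∀ᶠ e' in 𝓝 e, ¬ IsNonposInt (e' + u * k) :=
    (isOpen_not_isNonposInt.preimage (by fun_prop : Continuous fun e' : ℂ => e' + u * k)).mem_nhds hE
  have hc' : ∀ᶠ e' in 𝓝 e, 0 < (e' + lam - d - (∑ i, p i : ℕ) - v * k).re ∨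
      Terminates (ipdUpper p h u v d lam k) := by
    rcases hc with hc | hc
    · have hopen : IsOpen {e' : ℂ | 0 < (e' + lam - d - (∑ i, p i : ℕ) - v * k).re} :=
        isOpen_lt continuous_const (by fun_prop)
      filter_upwards [hopen.mem_nhds hc] with e' h1 using Or.inl h1
    · exact Eventually.of_forall fun _ => Or.inr hc
  filter_upwards [eventually_forall_ne_intCast e (lam - d), nhdsWithin_le_nhds hE',
    nhdsWithin_le_nhds hc'] with e' h1 h2 h3
  exact sum_gauss_eq_ipdRHS h2 (fun j hj => gaussCond_of_ipd hH h3 hj)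
    fun m => by rw [add_sub_assoc]; exact h1 m

/-! ### Degree and leading coefficient in `t` -/

theorem exists_polynomial_poch (a b : ℂ) (n : ℕ) : ∃ P : Polynomial ℂ,
    (∀ t, P.eval t = poch (a * t + b) n) ∧ P.natDegree ≤ n ∧ P.coeff n = a ^ n := by
  induction n with
  | zero => exact ⟨1, by simp [poch_zero], by simp, by simp⟩
  | succ n ih =>
    obtain ⟨P, h1, h2, h3⟩ := ih
    have h4 : (Polynomial.C a * Polynomial.X + Polynomial.C (b + n)).natDegree ≤ 1 :=
      Polynomial.natDegree_linear_le
    refine ⟨P * (Polynomial.C a * Polynomial.X + Polynomial.C (b + n)), fun t => ?_,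
      Polynomial.natDegree_mul_le_of_le h2 h4, ?_⟩
    · rw [poch_succ, Polynomial.eval_mul, h1]
      simp [add_assoc]
    · rw [Polynomial.coeff_mul_add_eq_of_natDegree_le h2 h4, h3, pow_succ]
      simp

theorem exists_polynomial_ipdY (p : Fin l → ℕ) (h : Fin l → ℂ) (u v : ℤ) (d e lam : ℂ) :
    ∃ P : Polynomial ℂ, (∀ t : ℂ, P.eval t = ipdY p h u v d e lam t) ∧
      P.natDegree ≤ ∑ i, p i ∧ P.coeff (∑ i, p i) = ipdLead p h u v d e := by
  choose Q hQ hQd hQc using exists_polynomial_poch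
  set N := ∑ i, p i with hN
  have hdeg : ∀ j ≤ N, (Q u d j * Q v (d - e - lam + j + 1) (N - j)).natDegree ≤ N := by
    intro j hj
    refine (Polynomial.natDegree_mul_le_of_le (hQd _ _ _) (hQd _ _ _)).trans ?_
    omega
  refine ⟨Polynomial.C (vecPoch (fun i => h i - d) p / Complex.Gamma (e - d)) *
    ∑ j ∈ Finset.range (N + 1),
      Polynomial.C (poch (d - e + 1) j / (j.factorial : ℂ) * ipdInner p h d j) *
        (Q u d j * Q v (d - e - lam + j + 1) (N - j)), fun t => ?_, ?_, ?_⟩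
  · rw [ipdY, Polynomial.eval_mul, Polynomial.eval_C, Polynomial.eval_finsetSum, ← hN]
    congr 1
    refine Finset.sum_congr rfl fun j _ => ?_
    rw [Polynomial.eval_mul, Polynomial.eval_C, Polynomial.eval_mul, hQ, hQ,
      show (v : ℂ) * t + (d - e - lam + j + 1) = v * t + d - e - lam + j + 1 by ring]
    ring
  · refine (Polynomial.natDegree_C_mul_le _ _).trans ?_
    refine Polynomial.natDegree_sum_le_of_forall_le _ _ fun j hj => ?_
    exact (Polynomial.natDegree_C_mul_le _ _).trans
      (hdeg j (Nat.lt_succ_iff.1 (Finset.mem_range.1 hj)))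
  · rw [ipdLead, Polynomial.coeff_C_mul, Polynomial.finsetSum_coeff, ← hN]
    congr 1
    refine Finset.sum_congr rfl fun j hj => ?_
    have hjN := Nat.lt_succ_iff.1 (Finset.mem_range.1 hj)
    have h1 := Polynomial.coeff_mul_add_eq_of_natDegree_le (hQd u d j)
      (hQd v (d - e - lam + j + 1) (N - j))
    rw [Nat.add_sub_cancel' hjN, hQc, hQc] at h1
    rw [Polynomial.coeff_C_mul, h1]
    ring

theorem sum_poch_zero_mul (f : ℕ → ℂ) (N : ℕ) :
    ∑ j ∈ Finset.range (N + 1), poch 0 j * f j = f 0 := by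
  rw [Finset.sum_range_succ', Finset.sum_eq_zero, poch_zero, one_mul, zero_add]
  intro j _
  have h1 := poch_neg_natCast_eq_zero (Nat.succ_pos j)
  rw [Nat.cast_zero, neg_zero] at h1
  rw [h1, zero_mul]

/-- Zeros come from `1 / Γ(e - d)`, at `e = d - m`, or from a polynomial `P` in `e`, so it suffices
that `P ≠ 0`. -/
theorem countable_ipdLead_eq_zero (hY : ∀ i, ¬ IsNonposInt (1 - h i + d - p i))
    (huv : (u, v) ≠ (0, 0)) : {e' : ℂ | ipdLead p h u v d e' = 0}.Countable := by
  choose Q hQ hQd hQc using exists_polynomial_poch (-1) (d + 1)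
  set N := ∑ i, p i with hN
  set P : Polynomial ℂ := ∑ j ∈ Finset.range (N + 1),
    Polynomial.C (ipdNewton p h d j * ((u : ℂ) ^ j * (v : ℂ) ^ (N - j))) * Q j with hP
  have hev : ∀ t, P.eval t = ∑ j ∈ Finset.range (N + 1), poch (d - t + 1) j *
      (ipdNewton p h d j * ((u : ℂ) ^ j * (v : ℂ) ^ (N - j))) := by
    intro t
    rw [hP, Polynomial.eval_finsetSum]
    refine Finset.sum_congr rfl fun j _ => ?_
    rw [Polynomial.eval_mul, Polynomial.eval_C, hQ,
      show -1 * t + (d + 1) = d - t + 1 by ring, mul_comm]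
  have hP0 : P ≠ 0 := by
    by_cases hu : u = 0
    · have hv : (v : ℂ) ≠ 0 := by
        rintro hv
        exact huv (by rw [hu, Int.cast_eq_zero.1 hv])
      intro h0
      -- For `u = 0`, evaluating at `e = d + 1` isolates the term `j = 0`, which is `(h - d)_p v^N`.
      have h1 := hev (d + 1)
      rw [h0, show d - (d + 1) + 1 = 0 by ring, sum_poch_zero_mul, ipdNewton_zero] at h1
      simp only [Polynomial.eval_zero, pow_zero, one_mul, Nat.sub_zero] at h1
      exact mul_ne_zero (vecPoch_sub_ne_zero hY) (pow_ne_zero _ hv) h1.symm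
    · intro h0
      -- For `u ≠ 0`, the top coefficient in `e` comes from `j = N` alone.
      have h1 : P.coeff N = (u : ℂ) ^ N * (-1) ^ N := by
        rw [hP, Polynomial.finsetSum_coeff, Finset.sum_range_succ, Finset.sum_eq_zero,
          Polynomial.coeff_C_mul, hQc, ipdNewton_sum_eq_one hY]
        · simp
        · intro j hj
          refine Polynomial.coeff_eq_zero_of_natDegree_lt
            ((Polynomial.natDegree_C_mul_le _ _).trans_lt ((hQd j).trans_lt ?_))
          exact Finset.mem_range.1 hj
      rw [h0, Polynomial.coeff_zero] at h1
      exact mul_ne_zero (pow_ne_zero _ (Int.cast_ne_zero.2 hu)) (pow_ne_zero _ (by norm_num)) h1.symm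
  refine ((Set.countable_range fun m : ℕ => d - m).union
    (P.roots.toFinset.countable_toSet)).mono fun e' he' => ?_
  rw [Set.mem_ofPred_eq, ipdLead, div_mul_eq_mul_div, div_eq_zero_iff] at he'
  rcases he' with he' | he'
  · right
    simp only [Finset.mem_coe, Multiset.mem_toFinset, Polynomial.mem_roots hP0,
      Polynomial.IsRoot.def]
    rw [hev, ← he', ← hN, Finset.mul_sum]
    exact Finset.sum_congr rfl fun j _ => by rw [ipdNewton]; ring
  · left
    obtain ⟨m, hm⟩ := (Complex.Gamma_eq_zero_iff _).1 he'
    exact ⟨m, by linear_combination -hm⟩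

/-! ### The case `e = d + 1` and Karlsson–Minton -/

theorem ipdY_add_one (p : Fin l → ℕ) (h : Fin l → ℂ) (u v : ℤ) (d lam t : ℂ) :
    ipdY p h u v d (d + 1) lam t =
      vecPoch (fun i => h i - d) p * poch (v * t - lam) (∑ i, p i) := by
  rw [ipdY, show d - (d + 1) + 1 = 0 by ring, add_sub_cancel_left, Complex.Gamma_one, div_one]
  congr 1
  simp only [div_eq_mul_inv, mul_assoc]
  rw [sum_poch_zero_mul, ipdInner_zero]
  simp only [Nat.factorial_zero, Nat.cast_one, inv_one, poch_zero, one_mul, Nat.cast_zero,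
    Nat.sub_zero]
  congr 1
  ring

/-- The Karlsson–Minton summation theorem. -/
theorem hasSum_karlsson_minton (hY : ∀ i, ¬ IsNonposInt (1 - h i + d - p i)) {a : ℂ}
    (ha : (a + (∑ i, p i : ℕ)).re < 1) (hd : ¬ IsNonposInt (d + 1))
    (hh : ∀ i, ¬ IsNonposInt (h i)) :
    HasSum (hypTerm (a :: d :: List.ofFn fun i => h i + p i) ((d + 1) :: List.ofFn h) 1)
      (Complex.Gamma (d + 1) * Complex.Gamma (1 - a) * vecPoch (fun i => h i - d) p /
        (Complex.Gamma (d + 1 - a) * vecPoch h p)) := by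
  have hG : ∀ j ≤ ∑ i, p i, 0 < (d + 1 - a - (d + j)).re := by
    intro j hj
    rw [show d + 1 - a - (d + j) = 1 - (a + j) by ring]
    simp only [Complex.sub_re, Complex.add_re, Complex.natCast_re, Complex.one_re] at ha ⊢
    have : (j : ℝ) ≤ (∑ i, p i : ℕ) := by exact_mod_cast hj
    linarith
  -- Starting from the Gauss sums rather than the gamma expression covers integer `a` without a
  -- limit.
  have h1 := hasSum_hypTerm_ipd (u := 0) (v := 0) (k := 0) (e := d + 1) (lam := -a) hY
    (by simpa using hd) (by simpa using hh) (by
      intro j hj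
      simp only [neg_neg, Int.cast_zero, Nat.cast_zero, mul_zero, add_zero]
      exact Or.inr (Or.inl (hG j hj)))
  simp only [ipdUpper, ipdLower, neg_neg, Int.cast_zero, Nat.cast_zero, mul_zero,
    add_zero] at h1
  refine (congrArg (HasSum _) ?_).mp h1
  have hsum : ∀ j ∈ Finset.range (∑ i, p i + 1),
      ∑' n, gaussTerm a (d + j) (d + 1) n = Complex.Gamma (d + 1) *
        Complex.Gamma (d + 1 - a - (d + j)) *
        ((Complex.Gamma (d + 1 - a))⁻¹ * (Complex.Gamma (d + 1 - (d + j)))⁻¹) := fun j hj => by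
    have hj' := hG j (Nat.lt_succ_iff.1 (Finset.mem_range.1 hj))
    exact tsum_gaussTerm hd (Or.inl hj') (not_isNonposInt_of_re_pos hj')
  rw [Finset.sum_congr rfl fun j hj => by rw [hsum j hj], Finset.sum_range_succ',
    Finset.sum_eq_zero, ipdNewton_zero]
  · simp only [poch_zero, Nat.cast_zero, add_zero, zero_add, one_mul, add_sub_cancel_left,
      Complex.Gamma_one, inv_one, mul_one]
    rw [show d + 1 - a - d = 1 - a by ring, div_eq_mul_inv, mul_inv]
    ring
  · intro j _
    -- Gauss's formula contains `1 / Γ(-j)`, which is `0`, so every term after the first drops out.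
    have h0 : Complex.Gamma (d + 1 - (d + (j + 1 : ℕ))) = 0 :=
      (Complex.Gamma_eq_zero_iff _).2 ⟨j, by push_cast; ring⟩
    rw [h0, inv_zero]
    ring

end

theorem lemma2 (l : ℕ) (p : Fin l → ℕ) (h : Fin l → ℂ) (u v : ℤ) (d e lam : ℂ)
    (hY : ∀ i, ¬ IsNonposInt (1 - h i + d - p i)) :
    -- the summation formula
    (∀ k : ℕ, ¬ IsNonposInt (e + u * k) → (∀ i, ¬ IsNonposInt (h i + u * k)) →
      (0 < (e + lam - d - (∑ i, p i : ℕ) - v * k).re ∨ Terminates (ipdUpper p h u v d lam k)) →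
        Summable (hypTerm (ipdUpper p h u v d lam k) (ipdLower h u e k) 1) ∧
        ((∀ m : ℤ, e + lam - d ≠ m) →
          hypF (ipdUpper p h u v d lam k) (ipdLower h u e k) 1 = ipdRHS p h u v d e lam k) ∧
        Tendsto (fun e' => ipdRHS p h u v d e' lam k) (𝓝[≠] e)
          (𝓝 (hypF (ipdUpper p h u v d lam k) (ipdLower h u e k) 1))) ∧
    -- `Y_p(u, v; t)` is a polynomial in `t`, of degree `p` for generic `e`
    (∃ P : Polynomial ℂ, (∀ t : ℂ, P.eval t = ipdY p h u v d e lam t) ∧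
      P.natDegree ≤ ∑ i, p i ∧ P.coeff (∑ i, p i) = ipdLead p h u v d e) ∧
    ((u, v) ≠ (0, 0) → {e' : ℂ | ipdLead p h u v d e' = 0}.Countable) ∧
    -- the case `e = d + 1`
    (∀ t : ℂ, ipdY p h u v d (d + 1) lam t
      = vecPoch (fun i => h i - d) p * poch (v * t - lam) (∑ i, p i)) ∧
    (∀ a : ℂ, (a + (∑ i, p i : ℕ)).re < 1 → ¬ IsNonposInt (d + 1) →
      (∀ i, ¬ IsNonposInt (h i)) →
        HasSum (hypTerm (a :: d :: List.ofFn fun i => h i + p i) ((d + 1) :: List.ofFn h) 1)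
          (Complex.Gamma (d + 1) * Complex.Gamma (1 - a) * vecPoch (fun i => h i - d) p /
            (Complex.Gamma (d + 1 - a) * vecPoch h p))) := by
  refine ⟨fun k hE hH hc => ?_, exists_polynomial_ipdY p h u v d e lam,
    countable_ipdLead_eq_zero hY, ipdY_add_one p h u v d lam,
    fun a ha hd hh => hasSum_karlsson_minton hY ha hd hh⟩
  have hG : ∀ j ≤ ∑ i, p i, poch (d + u * k) j = 0 ∨
      GaussCond (-lam + v * k) (d + u * k + j) (e + u * k) :=
    fun j hj => gaussCond_of_ipd hH hc hj
  have hsum := hasSum_hypTerm_ipd hY hE hH hG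
  exact ⟨hsum.summable, fun hs => hsum.tsum_eq.trans (sum_gauss_eq_ipdRHS hE hG hs),
    tendsto_ipdRHS hY hE hH hc⟩
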